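/- Consider the square lattice with vertex set $V=\mathbb Z^2$, edge set $E$ (pairs of nearest neighbours) and set $\tilde V$ of faces (unit squares); the dual lattice has vertex set $\tilde V$, and its edges join faces sharing an edge $e\in E$, each dual edge crossing exactly that $e$. For finite $\Lambda\subset E$ let $\mathcal A_\Lambda=\mathbb B\big(\bigotimes_{e\in\Lambda}\mathbb C^2\big)$, let $\mathcal A_{\rm loc}=\bigcup_\Lambda\mathcal A_\Lambda$ be the union along the inclusions $a\mapsto a\otimes 1$, and let $\mathcal A$ be the $C^*$-algebra obtained by completing $\mathcal A_{\rm loc}$ in the operator norm. Write $\sigma^x_e,\sigma^z_e\in\mathcal A$ for the Pauli matrices at the edge $e$, and define the star and face operators $$A_v=\prod_{e\ni v}\sigma^x_e\quad(v\in V),\qquad B_{\tilde v}=\prod_{e\in\partial\tilde v}\sigma^z_e\quad(\tilde v\in\tilde V),$$ and let $\mathcal C=C^*\{A_v,B_{\tilde v} \mid v\in V,\ \tilde v\in\tilde V\}\subseteq\mathcal A$. The ribbon operators are $$F^z_\rho=\prod_{e\in\rho}\sigma^z_e,\qquad F^x_{\tilde\rho}=\prod_{e\cap\tilde\rho\neq\emptyset}\sigma^x_e,$$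 where $\rho$ and $\tilde\rho$ run over the finite open non-self-intersecting paths, with at least one edge, on the lattice and on the dual lattice, respectively. For a $C^*$-subalgebra $\mathcal B\subseteq\mathcal A$, call $\mathcal B$ a masa if its relative commutant in $\mathcal A$ is $\mathcal B$ itself; call $a\in\mathcal A$ a normalizer of $\mathcal B$ if $a\mathcal Ba^*\cup a^*\mathcal Ba\subseteq\mathcal B$; and call a masa regular if its normalizers generate $\mathcal A$ as a $C^*$-algebra. **Proposition 3.2 (regular masa).** $\mathcal C$ is a regular masa of $\mathcal A$. Moreover, every ribbon operator is a normalizer of $\mathcal C$, and the ribbon operators generate $\mathcal A$ as a $C^*$-algebra. -/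

import Mathlib

open scoped Matrix.Norms.L2Operator Kronecker

namespace ToricCode

/-! ### The square lattice and its dual -/

/-- Vertices of the square lattice: the points of `ℤ²`. -/
abbrev Vertex : Type := ℤ × ℤ

/-- Faces of the square lattice (the vertices of the dual lattice): the face `(x, y)` is the unit
square `[x, x + 1] × [y, y + 1]`. -/
abbrev Face : Type := ℤ × ℤ

/-- Unoriented edges of the square lattice: `((x, y), false)` is the horizontal edge joining
`(x, y)` to `(x + 1, y)`, and `((x, y), true)` is the vertical edge joining `(x, y)` to
`(x, y + 1)`. -/
abbrev Edge : Type := (ℤ × ℤ) × Bool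

/-- The two end vertices of an edge. -/
def endVertices : Edge → Sym2 Vertex
  | ((x, y), false) => s((x, y), (x + 1, y))
  | ((x, y), true) => s((x, y), (x, y + 1))

/-- The two faces that have a given edge in their boundary. The dual edge that crosses `e`
transversally joins (the centres of) these two faces, so dual edges are indexed by the edges they
cross, and `sideFaces e` is the pair of ends of the dual edge crossing `e`. -/
def sideFaces : Edge → Sym2 Face
  | ((x, y), false) => s((x, y - 1), (x, y))
  | ((x, y), true) => s((x - 1, y), (x, y))

/-- The edges meeting at a vertex. -/
def starEdges (v : Vertex) : List Edge :=
  [((v.1, v.2), false), ((v.1, v.2), true), ((v.1 - 1, v.2), false), ((v.1, v.2 - 1), true)]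

/-- The edges in the boundary of a face. -/
def faceEdges (p : Face) : List Edge :=
  [((p.1, p.2), false), ((p.1 + 1, p.2), true), ((p.1, p.2 + 1), false), ((p.1, p.2), true)]

theorem mem_starEdges (v : Vertex) (e : Edge) : e ∈ starEdges v ↔ v ∈ endVertices e := by
  obtain ⟨a, b⟩ := v
  obtain ⟨⟨x, y⟩, _ | _⟩ := e <;> simp [starEdges, endVertices] <;> omega

theorem mem_faceEdges (p : Face) (e : Edge) : e ∈ faceEdges p ↔ p ∈ sideFaces e := by
  obtain ⟨a, b⟩ := p
  obtain ⟨⟨x, y⟩, _ | _⟩ := e <;> simp [faceEdges, sideFaces] <;> omega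

theorem nodup_starEdges (v : Vertex) : (starEdges v).Nodup := by
  obtain ⟨a, b⟩ := v
  simp [starEdges]
  omega

theorem nodup_faceEdges (p : Face) : (faceEdges p).Nodup := by
  obtain ⟨a, b⟩ := p
  simp [faceEdges]

/-- A finite, open, non self-intersecting path in the graph with vertex set `W`, edge set `Edge`
and end map `ends`: pairwise distinct vertices `v₀, …, vₙ`, `n ≥ 1`, and for each `i < n` an edge
joining `vᵢ` to `vᵢ₊₁`. With `ends = endVertices` this is a path on the lattice; with
`ends = sideFaces` it is a path on the dual lattice, given by the edges that it crosses. -/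
structure OpenPath {W : Type} (ends : Edge → Sym2 W) where
  length : ℕ
  length_pos : 0 < length
  vertex : Fin (length + 1) → W
  edge : Fin length → Edge
  injective : Function.Injective vertex
  joins : ∀ i : Fin length, ends (edge i) = s(vertex i.castSucc, vertex i.succ)

/-! ### The local algebras -/

/-- `𝒜_Λ = 𝔹(⨂_{e ∈ Λ} ℂ²)`, as matrices indexed by the product basis of `⨂_{e ∈ Λ} ℂ²`, that is
by the configurations `Λ → Fin 2`. The norm is the operator norm for the Hilbert space norm, the
star is the conjugate transpose. -/
abbrev LocalAlgebra (Λ : Finset Edge) : Type := Matrix (Λ → Fin 2) (Λ → Fin 2) ℂ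

/-- For `Λ ⊆ Λ'`, a configuration on `Λ'` is one on `Λ` together with one on `Λ' \ Λ`. -/
def splitConfig {Λ Λ' : Finset Edge} (h : Λ ≤ Λ') :
    (Λ' → Fin 2) ≃ (Λ → Fin 2) × ({e : Λ' // e.1 ∉ Λ} → Fin 2) where
  toFun s := (fun e => s ⟨e.1, h e.2⟩, fun e => s e.1)
  invFun p e := if he : e.1 ∈ Λ then p.1 ⟨e.1, he⟩ else p.2 ⟨e, he⟩
  left_inv s := by
    funext e
    by_cases he : e.1 ∈ Λ <;> simp [he]
  right_inv p := by
    ext e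
    · simp
    · simp [e.2]

/-- The natural inclusion `𝒜_Λ → 𝒜_Λ'`, `a ↦ a ⊗ 1`, for `Λ ⊆ Λ'`. -/
def localInclusion (Λ Λ' : Finset Edge) (h : Λ ≤ Λ') :
    LocalAlgebra Λ →⋆ₐ[ℂ] LocalAlgebra Λ' where
  toFun a := (a ⊗ₖ (1 : Matrix ({e : Λ' // e.1 ∉ Λ} → Fin 2) ({e : Λ' // e.1 ∉ Λ} → Fin 2) ℂ)).submatrix
    (splitConfig h) (splitConfig h)
  map_one' := by simp
  map_mul' a b := by
    rw [Matrix.submatrix_mul_equiv, ← Matrix.mul_kronecker_mul, one_mul]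
  map_zero' := by simp
  map_add' a b := by rw [Matrix.add_kronecker]; rfl
  commutes' r := by
    simp only [Algebra.algebraMap_eq_smul_one, Matrix.smul_kronecker, Matrix.one_kronecker_one,
      Matrix.submatrix_smul, Pi.smul_apply, Matrix.submatrix_one_equiv]
  map_star' a := by
    simp only [Matrix.star_eq_conjTranspose, Matrix.conjTranspose_submatrix,
      Matrix.conjTranspose_kronecker, Matrix.conjTranspose_one]

theorem localInclusion_apply {Λ Λ' : Finset Edge} (h : Λ ≤ Λ') (a : LocalAlgebra Λ)
    (s t : Λ' → Fin 2) :
    localInclusion Λ Λ' h a s t =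
      if ∀ e : Λ', e.1 ∉ Λ → s e = t e then
        a (fun e => s ⟨e.1, h e.2⟩) (fun e => t ⟨e.1, h e.2⟩) else 0 := by
  have hmul : localInclusion Λ Λ' h a s t = a (splitConfig h s).1 (splitConfig h t).1 *
      (1 : Matrix ({e : Λ' // e.1 ∉ Λ} → Fin 2) ({e : Λ' // e.1 ∉ Λ} → Fin 2) ℂ)
        (splitConfig h s).2 (splitConfig h t).2 := rfl
  rw [hmul, Matrix.one_apply]
  have key : (splitConfig h s).2 = (splitConfig h t).2 ↔ ∀ e : Λ', e.1 ∉ Λ → s e = t e := by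
    rw [funext_iff, Subtype.forall]
    rfl
  by_cases hst : ∀ e : Λ', e.1 ∉ Λ → s e = t e
  · rw [if_pos (key.2 hst), if_pos hst, mul_one]
    rfl
  · rw [if_neg (fun h' => hst (key.1 h')), if_neg hst, mul_zero]

theorem localInclusion_injective (Λ Λ' : Finset Edge) (h : Λ ≤ Λ') :
    Function.Injective (localInclusion Λ Λ' h) := by
  intro a b hab
  ext s t
  have := congrFun (congrFun hab ((splitConfig h).symm (s, 0))) ((splitConfig h).symm (t, 0))
  simpa [localInclusion] using this

theorem norm_localInclusion (Λ Λ' : Finset Edge) (h : Λ ≤ Λ') (a : LocalAlgebra Λ) :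
    ‖localInclusion Λ Λ' h a‖ = ‖a‖ :=
  NonUnitalStarAlgHom.norm_map (localInclusion Λ Λ' h) (localInclusion_injective Λ Λ' h) a

instance : DirectedSystem LocalAlgebra (localInclusion · · ·) where
  map_self Λ a := by
    ext s t
    rw [localInclusion_apply, if_pos (fun e he => absurd e.2 he)]
  map_map Λ₃ Λ₂ Λ₁ h₁₂ h₂₃ a := by
    ext s t
    simp only [localInclusion_apply]
    by_cases h : ∀ e : Λ₃, e.1 ∉ Λ₁ → s e = t e
    · rw [if_pos h, if_pos (fun (e : Λ₃) (he : e.1 ∉ Λ₂) => h e fun h' => he (h₁₂ h')),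
        if_pos (fun (e : Λ₂) (he : e.1 ∉ Λ₁) => h ⟨e.1, h₂₃ e.2⟩ he)]
    · rw [if_neg h]
      split_ifs with h₂ h₁
      · refine absurd (fun e he => ?_) h
        by_cases he₂ : e.1 ∈ Λ₂
        · exact h₁ ⟨e.1, he₂⟩ he
        · exact h₂ e he₂
      · rfl
      · rfl

/-! ### The quasi-local algebra -/

/-- The algebra `𝒜_loc = ⋃_Λ 𝒜_Λ` of local observables: the direct limit of the `𝒜_Λ` along the
natural inclusions. -/
abbrev LocalObservables : Type := DirectLimit LocalAlgebra localInclusion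

noncomputable section

/-- The norm of a local observable is its operator norm in any `𝒜_Λ` that contains it. -/
instance : Norm LocalObservables where
  norm := DirectLimit.lift localInclusion (fun _ a => ‖a‖)
    (fun Λ Λ' h a => (norm_localInclusion Λ Λ' h a).symm)

theorem norm_mk (Λ : Finset Edge) (a : LocalAlgebra Λ) :
    ‖(⟦⟨Λ, a⟩⟧ : LocalObservables)‖ = ‖a‖ := rfl

instance : NormedAddCommGroup LocalObservables :=
  AddGroupNorm.toNormedAddCommGroup
    { toFun := fun a => ‖a‖
      map_zero' := by
        rw [DirectLimit.zero_def (f := localInclusion) (∅ : Finset Edge), norm_mk, norm_zero]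
      add_le' := fun a b => by
        induction a, b using DirectLimit.induction₂ with
        | _ Λ a b => rw [DirectLimit.add_def, norm_mk, norm_mk, norm_mk]; exact norm_add_le a b
      neg' := fun a => by
        induction a using DirectLimit.induction with
        | _ Λ a => rw [DirectLimit.neg_def, norm_mk, norm_mk, norm_neg]
      eq_zero_of_map_eq_zero' := fun a => by
        induction a using DirectLimit.induction with
        | _ Λ a =>
          intro h
          rw [norm_mk, norm_eq_zero] at h
          rw [h, ← DirectLimit.zero_def] }

instance : NormedRing LocalObservables :=
  { (inferInstance : Ring LocalObservables), (inferInstance : NormedAddCommGroup LocalObservables) with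
    norm_mul_le := fun a b => by
      induction a, b using DirectLimit.induction₂ with
      | _ Λ a b => rw [DirectLimit.mul_def, norm_mk, norm_mk, norm_mk]; exact norm_mul_le a b }

instance : NormedAlgebra ℂ LocalObservables :=
  { (inferInstance : Algebra ℂ LocalObservables) with
    norm_smul_le := fun r a => by
      induction a using DirectLimit.induction with
      | _ Λ a => rw [DirectLimit.smul_def, norm_mk, norm_mk]; exact norm_smul_le r a }

/-- The quasi-local algebra `𝒜`: the completion of `𝒜_loc` in its norm. -/
abbrev QuasiLocal : Type := UniformSpace.Completion LocalObservables

theorem norm_star_localObservables (a : LocalObservables) : ‖star a‖ = ‖a‖ := by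
  induction a using DirectLimit.induction with
  | _ Λ a => rw [DirectLimit.star_def, norm_mk, norm_mk, norm_star]

theorem isometry_star_localObservables : Isometry (star : LocalObservables → LocalObservables) :=
  AddMonoidHomClass.isometry_of_norm (starAddEquiv : LocalObservables ≃+ LocalObservables)
    norm_star_localObservables

/-- The involution of `𝒜` is the continuous extension of that of `𝒜_loc`. -/
instance : Star QuasiLocal where
  star := UniformSpace.Completion.map star

theorem star_coe (a : LocalObservables) : star (a : QuasiLocal) = ((star a : LocalObservables) : QuasiLocal) :=
  UniformSpace.Completion.map_coe isometry_star_localObservables.uniformContinuous a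

theorem continuous_star_quasiLocal : Continuous (star : QuasiLocal → QuasiLocal) :=
  UniformSpace.Completion.continuous_map

instance : StarRing QuasiLocal where
  star_involutive a := by
    induction a using UniformSpace.Completion.induction_on with
    | hp => exact isClosed_eq (continuous_star_quasiLocal.comp continuous_star_quasiLocal) continuous_id
    | ih a => rw [star_coe, star_coe, star_star]
  star_mul a b := by
    induction a, b using UniformSpace.Completion.induction_on₂ with
    | hp => exact isClosed_eq (continuous_star_quasiLocal.comp (by fun_prop))
              ((continuous_star_quasiLocal.comp continuous_snd).mul
                (continuous_star_quasiLocal.comp continuous_fst))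
    | ih a b => rw [← UniformSpace.Completion.coe_mul, star_coe, star_coe, star_coe, star_mul,
                  UniformSpace.Completion.coe_mul]
  star_add a b := by
    induction a, b using UniformSpace.Completion.induction_on₂ with
    | hp => exact isClosed_eq (continuous_star_quasiLocal.comp (by fun_prop))
              ((continuous_star_quasiLocal.comp continuous_fst).add
                (continuous_star_quasiLocal.comp continuous_snd))
    | ih a b => rw [← UniformSpace.Completion.coe_add, star_coe, star_coe, star_coe, star_add,
                  UniformSpace.Completion.coe_add]

instance : StarModule ℂ QuasiLocal where
  star_smul r a := by
    induction a using UniformSpace.Completion.induction_on with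
    | hp => exact isClosed_eq (continuous_star_quasiLocal.comp (continuous_const_smul r))
              (continuous_star_quasiLocal.const_smul (star r))
    | ih a => rw [← UniformSpace.Completion.coe_smul, star_coe, star_coe, star_smul,
                  UniformSpace.Completion.coe_smul]

instance : CStarRing QuasiLocal where
  norm_mul_self_le a := by
    induction a using UniformSpace.Completion.induction_on with
    | hp => exact isClosed_le (by fun_prop)
              ((continuous_star_quasiLocal.mul continuous_id).norm)
    | ih a =>
      rw [star_coe, ← UniformSpace.Completion.coe_mul, UniformSpace.Completion.norm_coe,
        UniformSpace.Completion.norm_coe]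
      induction a using DirectLimit.induction with
      | _ Λ a =>
        rw [DirectLimit.star_def, DirectLimit.mul_def, norm_mk, norm_mk]
        exact CStarRing.norm_mul_self_le a

/-- `𝒜` is a unital C*-algebra. -/
instance : CStarAlgebra QuasiLocal where
  norm_smul_le := norm_smul_le

/-- The inclusion `𝒜_Λ → 𝒜`. -/
def localEmbedding (Λ : Finset Edge) : LocalAlgebra Λ →⋆ₐ[ℂ] QuasiLocal where
  toFun a := ((⟦⟨Λ, a⟩⟧ : LocalObservables) : QuasiLocal)
  map_one' := by
    rw [← DirectLimit.one_def (f := localInclusion) Λ, UniformSpace.Completion.coe_one]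
  map_mul' a b := by
    rw [← DirectLimit.mul_def, UniformSpace.Completion.coe_mul]
  map_zero' := by
    rw [← DirectLimit.zero_def (f := localInclusion) Λ, UniformSpace.Completion.coe_zero]
  map_add' a b := by
    rw [← DirectLimit.add_def, UniformSpace.Completion.coe_add]
  commutes' r := by
    rw [← DirectLimit.algebraMap_def]; rfl
  map_star' a := by
    rw [star_coe, DirectLimit.star_def]

theorem norm_localEmbedding (Λ : Finset Edge) (a : LocalAlgebra Λ) : ‖localEmbedding Λ a‖ = ‖a‖ :=
  UniformSpace.Completion.norm_coe _

theorem localEmbedding_localInclusion {Λ Λ' : Finset Edge} (h : Λ ≤ Λ') (a : LocalAlgebra Λ) :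
    localEmbedding Λ' (localInclusion Λ Λ' h a) = localEmbedding Λ a :=
  congrArg (fun x : LocalObservables => (x : QuasiLocal))
    (DirectLimit.eq_of_le (f := localInclusion) ⟨Λ, a⟩ Λ' h).symm

theorem dense_iUnion_range_localEmbedding :
    Dense (⋃ Λ, Set.range (localEmbedding Λ)) := by
  refine UniformSpace.Completion.denseRange_coe.mono ?_
  rintro _ ⟨a, rfl⟩
  induction a using DirectLimit.induction with
  | _ Λ a => exact Set.mem_iUnion.2 ⟨Λ, a, rfl⟩

/-! ### Star, face and ribbon operators -/

/-- The element of `𝒜_e ⊆ 𝒜` given by a `2 × 2` matrix. -/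
def siteOperator (e : Edge) (m : Matrix (Fin 2) (Fin 2) ℂ) : QuasiLocal :=
  localEmbedding {e} (Matrix.of fun s t =>
    m (s ⟨e, Finset.mem_singleton_self e⟩) (t ⟨e, Finset.mem_singleton_self e⟩))

/-- The Pauli matrix `σˣ` at the edge `e`. -/
def sigmaX (e : Edge) : QuasiLocal := siteOperator e !![0, 1; 1, 0]

/-- The Pauli matrix `σᶻ` at the edge `e`. -/
def sigmaZ (e : Edge) : QuasiLocal := siteOperator e !![1, 0; 0, -1]

/-- The star operator `A_v`, the product of `σˣ` over the edges at `v`. -/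
def starOperator (v : Vertex) : QuasiLocal := ((starEdges v).map sigmaX).prod

/-- The face operator `B_p`, the product of `σᶻ` over the edges in the boundary of `p`. -/
def faceOperator (p : Face) : QuasiLocal := ((faceEdges p).map sigmaZ).prod

/-- The ribbon operator of a lattice path, the product of `σᶻ` over the edges of the path. -/
def ribbonZ (ρ : OpenPath endVertices) : QuasiLocal :=
  (List.ofFn fun i => sigmaZ (ρ.edge i)).prod

/-- The ribbon operator of a dual lattice path, the product of `σˣ` over the lattice edges that the
path crosses. -/
def ribbonX (ρ : OpenPath sideFaces) : QuasiLocal :=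
  (List.ofFn fun i => sigmaX (ρ.edge i)).prod

/-- The set of all ribbon operators. -/
def ribbonOperators : Set QuasiLocal := Set.range ribbonZ ∪ Set.range ribbonX

/-! ### C*-subalgebras -/

/-- The (unital) C*-subalgebra generated by a set. -/
def generatedCStar {A : Type*} [CStarAlgebra A] (S : Set A) : StarSubalgebra ℂ A :=
  (StarAlgebra.adjoin ℂ S).topologicalClosure

/-- `B` is a maximal abelian C*-subalgebra of `A`: the relative commutant of `B` in `A` is `B`
itself (in particular `B` is commutative and norm closed). -/
def IsMasa {A : Type*} [CStarAlgebra A] (B : StarSubalgebra ℂ A) : Prop :=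
  Set.centralizer (B : Set A) = (B : Set A)

/-- `a` is a normalizer of `B`: `a B a* ∪ a* B a ⊆ B`. -/
def IsNormalizer {A : Type*} [CStarAlgebra A] (B : StarSubalgebra ℂ A) (a : A) : Prop :=
  ∀ b ∈ B, a * b * star a ∈ B ∧ star a * b * a ∈ B

/-- `B` is a regular masa of `A`: it is a masa whose normalizers generate `A`. -/
def IsRegularMasa {A : Type*} [CStarAlgebra A] (B : StarSubalgebra ℂ A) : Prop :=
  IsMasa B ∧ generatedCStar {a | IsNormalizer B a} = ⊤

/-- The C*-subalgebra `𝒞` of `𝒜` generated by the star and face operators. -/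
def toricAlgebra : StarSubalgebra ℂ QuasiLocal :=
  generatedCStar (Set.range starOperator ∪ Set.range faceOperator)

end

end ToricCode

/-! For finite chains `S`, `T` of edges modulo two, let `pauli S T` be the product of `σˣ` over `S`
and `σᶻ` over `T`. These Pauli strings span a dense subspace of `𝒜`, because the Pauli matrices
generate every local matrix algebra. Each star or face operator commutes or anticommutes with each
string: `A_v` sees the parity of `T` at `v`, and `B_p` sees the parity of `S` around `p`.

A string commuting with all stabilizers therefore has `T` a cycle and `S` a dual cycle. The plane
has no first homology, so `T` is a sum of face boundaries and `S` a sum of stars (`mem_boundaries`,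
`mem_coboundaries`), and the string lies in `𝒞`. Every other string anticommutes with some
stabilizer `g`, and averaging over conjugation by `1` and `g` kills it
(`pauli_mem_or_anticommutes`).

This gives the masa property (`isMasa_generatedCStar`). If `a` commutes with `𝒞`, approximate it by
a finite combination `b` of strings. A suitable composition `E` of averages is contractive, fixes
`a` and sends `b` into `𝒞`, so `‖a - E b‖ ≤ ‖a - b‖` and `a` lies in the closed algebra `𝒞`.

A ribbon operator is a self-adjoint unitary string, so conjugation by it only changes signs of the
generators of `𝒞`, which makes it a normalizer. Paths with one edge give all the Pauli matrices, so
ribbons generate `𝒜`, and regularity follows. -/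

namespace ToricCode

noncomputable section

/-! ### Pauli matrices in the local algebras -/

/-- The configuration with the spin at `e` flipped. -/
def flipAt {Λ : Finset Edge} (e : Λ) (s : Λ → Fin 2) : Λ → Fin 2 :=
  Function.update s e (1 - s e)

theorem flipAt_same {Λ : Finset Edge} (e : Λ) (s : Λ → Fin 2) : flipAt e s e = 1 - s e := by
  simp [flipAt]

theorem flipAt_of_ne {Λ : Finset Edge} {e f : Λ} (h : f ≠ e) (s : Λ → Fin 2) :
    flipAt e s f = s f := by
  simp [flipAt, h]

theorem flipAt_flipAt {Λ : Finset Edge} (e : Λ) (s : Λ → Fin 2) : flipAt e (flipAt e s) = s := by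
  funext f
  by_cases h : f = e
  · subst h; rw [flipAt_same, flipAt_same, sub_sub_cancel]
  · rw [flipAt_of_ne h, flipAt_of_ne h]

theorem flipAt_comm {Λ : Finset Edge} (e f : Λ) (s : Λ → Fin 2) :
    flipAt e (flipAt f s) = flipAt f (flipAt e s) := by
  by_cases hef : e = f
  · rw [hef]
  · rw [flipAt, flipAt, flipAt, flipAt, Function.update_of_ne hef,
      Function.update_of_ne (Ne.symm hef), Function.update_comm hef]

theorem eq_flipAt_comm {Λ : Finset Edge} (e : Λ) (s t : Λ → Fin 2) :
    t = flipAt e s ↔ s = flipAt e t := by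
  constructor <;> rintro rfl <;> rw [flipAt_flipAt]

/-- The matrix `σˣ` at the edge `e` in `𝒜_Λ`. -/
def localX {Λ : Finset Edge} (e : Λ) : LocalAlgebra Λ :=
  Matrix.of fun s t => if t = flipAt e s then 1 else 0

/-- The sign of a configuration at the edge `e`. -/
def spin {Λ : Finset Edge} (e : Λ) (s : Λ → Fin 2) : ℂ := if s e = 0 then 1 else -1

/-- The matrix `σᶻ` at the edge `e` in `𝒜_Λ`. -/
def localZ {Λ : Finset Edge} (e : Λ) : LocalAlgebra Λ := Matrix.diagonal (spin e)

theorem localX_mul_apply {Λ : Finset Edge} (e : Λ) (m : LocalAlgebra Λ) (s t : Λ → Fin 2) :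
    (localX e * m) s t = m (flipAt e s) t := by
  simp [localX, Matrix.mul_apply]

theorem mul_localX_apply {Λ : Finset Edge} (e : Λ) (m : LocalAlgebra Λ) (s t : Λ → Fin 2) :
    (m * localX e) s t = m s (flipAt e t) := by
  simp only [localX, Matrix.mul_apply, Matrix.of_apply, mul_ite, mul_one, mul_zero]
  simp only [eq_flipAt_comm e _ t, Finset.sum_ite_eq', Finset.mem_univ, if_true]

theorem localX_mul_self {Λ : Finset Edge} (e : Λ) : localX e * localX e = 1 := by
  ext s t
  rw [localX_mul_apply, localX, Matrix.of_apply, flipAt_flipAt, Matrix.one_apply]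
  simp [eq_comm]

theorem localX_comm {Λ : Finset Edge} (e f : Λ) : localX e * localX f = localX f * localX e := by
  ext s t
  rw [localX_mul_apply, localX_mul_apply, localX, localX, Matrix.of_apply, Matrix.of_apply,
    flipAt_comm]

theorem star_localX {Λ : Finset Edge} (e : Λ) : star (localX e) = localX e := by
  ext s t
  rw [Matrix.star_apply, localX, Matrix.of_apply, Matrix.of_apply,
    if_congr (eq_flipAt_comm e t s) rfl rfl]
  split_ifs <;> simp

theorem spin_mul_self {Λ : Finset Edge} (e : Λ) (s : Λ → Fin 2) : spin e s * spin e s = 1 := by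
  rw [spin]; split_ifs <;> simp

theorem spin_flipAt_same {Λ : Finset Edge} (e : Λ) (s : Λ → Fin 2) :
    spin e (flipAt e s) = -spin e s := by
  rw [spin, spin, flipAt_same]
  generalize s e = a
  fin_cases a <;> simp

theorem spin_flipAt_of_ne {Λ : Finset Edge} {e f : Λ} (h : f ≠ e) (s : Λ → Fin 2) :
    spin f (flipAt e s) = spin f s := by
  rw [spin, spin, flipAt_of_ne h]

theorem localZ_mul_self {Λ : Finset Edge} (e : Λ) : localZ e * localZ e = 1 := by
  simp [localZ, spin_mul_self]

theorem localZ_comm {Λ : Finset Edge} (e f : Λ) : localZ e * localZ f = localZ f * localZ e := by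
  simp [localZ, mul_comm]

theorem star_localZ {Λ : Finset Edge} (e : Λ) : star (localZ e) = localZ e := by
  rw [localZ, Matrix.star_eq_conjTranspose, Matrix.diagonal_conjTranspose]
  congr 1
  funext s
  rw [Pi.star_apply, spin]
  split_ifs <;> simp

theorem localX_mul_localZ_same {Λ : Finset Edge} (e : Λ) :
    localX e * localZ e = -(localZ e * localX e) := by
  ext s t
  rw [Matrix.neg_apply, localX_mul_apply, mul_localX_apply, localZ, Matrix.diagonal_apply,
    Matrix.diagonal_apply, spin_flipAt_same]
  by_cases h : flipAt e s = t
  · rw [if_pos h, if_pos ((eq_flipAt_comm e s t).1 h.symm)]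
  · rw [if_neg h, if_neg fun h' => h ((eq_flipAt_comm e t s).1 h').symm, neg_zero]

theorem localX_mul_localZ_of_ne {Λ : Finset Edge} {e f : Λ} (hf : f ≠ e) :
    localX e * localZ f = localZ f * localX e := by
  ext s t
  rw [localX_mul_apply, mul_localX_apply, localZ, Matrix.diagonal_apply,
    Matrix.diagonal_apply, spin_flipAt_of_ne hf]
  by_cases h : flipAt e s = t
  · rw [if_pos h, if_pos ((eq_flipAt_comm e s t).1 h.symm)]
  · rw [if_neg h, if_neg fun h' => h ((eq_flipAt_comm e t s).1 h').symm]

/-- An operator at `e` can be computed in any `𝒜_Λ` with `e ∈ Λ`. Relations between Pauli operators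
at two edges thus become matrix identities over `{e, f}`. -/
theorem siteOperator_eq {Λ : Finset Edge} (e : Λ) (m : Matrix (Fin 2) (Fin 2) ℂ) :
    siteOperator e m = localEmbedding Λ (Matrix.of fun s t =>
      if ∀ f : Λ, f ≠ e → s f = t f then m (s e) (t e) else 0) := by
  rw [siteOperator, ← localEmbedding_localInclusion
    (Finset.singleton_subset_iff.2 e.2 : ({e.1} : Finset Edge) ≤ Λ)]
  congr 1
  ext s t
  rw [localInclusion_apply, Matrix.of_apply, Matrix.of_apply]
  refine if_congr (forall_congr' fun f => imp_congr ?_ Iff.rfl) rfl rfl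
  rw [Finset.mem_singleton, ne_eq, Subtype.ext_iff]

theorem localEmbedding_localX {Λ : Finset Edge} (e : Λ) :
    localEmbedding Λ (localX e) = sigmaX e := by
  rw [sigmaX, siteOperator_eq]
  congr 1
  ext s t
  rw [localX, Matrix.of_apply, Matrix.of_apply]
  by_cases h : ∀ f : Λ, f ≠ e → s f = t f
  · rw [if_pos h]
    have key : t = flipAt e s ↔ t e = 1 - s e := by
      refine ⟨fun h' => by rw [h', flipAt_same], fun h' => funext fun f => ?_⟩
      by_cases hf : f = e
      · rw [hf, h', flipAt_same]
      · rw [flipAt_of_ne hf, h f hf]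
    rw [if_congr key rfl rfl]
    generalize s e = a
    generalize t e = b
    fin_cases a <;> fin_cases b <;> simp
  · rw [if_neg h, if_neg]
    rintro rfl
    exact h fun f hf => (flipAt_of_ne hf s).symm

theorem localEmbedding_localZ {Λ : Finset Edge} (e : Λ) :
    localEmbedding Λ (localZ e) = sigmaZ e := by
  rw [sigmaZ, siteOperator_eq]
  congr 1
  ext s t
  rw [localZ, Matrix.of_apply, Matrix.diagonal_apply]
  by_cases h : s = t
  · subst h
    rw [if_pos rfl, if_pos fun _ _ => rfl, spin]
    generalize s e = a
    fin_cases a <;> simp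
  · rw [if_neg h]
    split_ifs with h'
    · have hne : s e ≠ t e := fun he => h (funext fun f => by
        by_cases hf : f = e
        · rw [hf, he]
        · exact h' f hf)
      revert hne
      generalize s e = a
      generalize t e = b
      fin_cases a <;> fin_cases b <;> simp
    · rfl

/-! ### Relations between Pauli operators -/

theorem sigmaX_mul_self (e : Edge) : sigmaX e * sigmaX e = 1 := by
  rw [← localEmbedding_localX (Λ := {e}) ⟨e, by simp⟩, ← map_mul, localX_mul_self, map_one]

theorem sigmaZ_mul_self (e : Edge) : sigmaZ e * sigmaZ e = 1 := by
  rw [← localEmbedding_localZ (Λ := {e}) ⟨e, by simp⟩, ← map_mul, localZ_mul_self, map_one]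

theorem star_sigmaX (e : Edge) : star (sigmaX e) = sigmaX e := by
  rw [← localEmbedding_localX (Λ := {e}) ⟨e, by simp⟩, ← map_star, star_localX]

theorem star_sigmaZ (e : Edge) : star (sigmaZ e) = sigmaZ e := by
  rw [← localEmbedding_localZ (Λ := {e}) ⟨e, by simp⟩, ← map_star, star_localZ]

theorem sigmaX_comm (e f : Edge) : Commute (sigmaX e) (sigmaX f) := by
  rw [← localEmbedding_localX (Λ := {e, f}) ⟨e, by simp⟩,
    ← localEmbedding_localX (Λ := {e, f}) ⟨f, by simp⟩]
  exact Commute.map (localX_comm _ _) (localEmbedding {e, f})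

theorem sigmaZ_comm (e f : Edge) : Commute (sigmaZ e) (sigmaZ f) := by
  rw [← localEmbedding_localZ (Λ := {e, f}) ⟨e, by simp⟩,
    ← localEmbedding_localZ (Λ := {e, f}) ⟨f, by simp⟩]
  exact Commute.map (localZ_comm _ _) (localEmbedding {e, f})

theorem sigmaX_mul_sigmaZ_same (e : Edge) : sigmaX e * sigmaZ e = -(sigmaZ e * sigmaX e) := by
  rw [← localEmbedding_localX (Λ := {e}) ⟨e, by simp⟩,
    ← localEmbedding_localZ (Λ := {e}) ⟨e, by simp⟩, ← map_mul, ← map_mul, ← map_neg,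
    localX_mul_localZ_same]

theorem sigmaX_comm_sigmaZ {e f : Edge} (h : f ≠ e) : Commute (sigmaX e) (sigmaZ f) := by
  rw [← localEmbedding_localX (Λ := {e, f}) ⟨e, by simp⟩,
    ← localEmbedding_localZ (Λ := {e, f}) ⟨f, by simp⟩]
  exact Commute.map (localX_mul_localZ_of_ne (by simpa using h)) (localEmbedding {e, f})

/-! ### The Pauli operators generate the quasi-local algebra -/

/-- The rank-one projection onto `s` is the product over `e` of the spectral projections `(1 + spin
e s • localZ e) / 2`. -/
theorem single_one_mem_of_localZ_mem {Λ : Finset Edge} (D : Subalgebra ℂ (LocalAlgebra Λ))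
    (hZ : ∀ e, localZ e ∈ D) (s : Λ → Fin 2) : Matrix.single s s (1 : ℂ) ∈ D := by
  have hproj (e : Λ) : Matrix.diagonalAlgHom ℂ
      (fun t : Λ → Fin 2 => if t e = s e then (1 : ℂ) else 0) ∈ D := by
    have : (fun t : Λ → Fin 2 => if t e = s e then (1 : ℂ) else 0) =
        (2⁻¹ : ℂ) • (1 + spin e s • spin e) := by
      funext t
      simp only [Pi.smul_apply, Pi.add_apply, Pi.one_apply, smul_eq_mul, spin]
      generalize s e = a
      generalize t e = b
      fin_cases a <;> fin_cases b <;> norm_num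
    rw [this, map_smul, map_add, map_one, map_smul]
    exact D.smul_mem (D.add_mem D.one_mem (D.smul_mem (hZ e) _)) _
  have hprod : Matrix.single s s (1 : ℂ) = Matrix.diagonalAlgHom ℂ
      (∏ e, fun t : Λ → Fin 2 => if t e = s e then (1 : ℂ) else 0) := by
    rw [← Matrix.diagonal_single]
    refine congrArg Matrix.diagonal (funext fun t => ?_)
    rw [Finset.prod_apply, Fintype.prod_boole, Pi.single_apply, if_congr funext_iff rfl rfl]
  rw [hprod]
  exact (D.comap (Matrix.diagonalAlgHom ℂ)).prod_mem fun e _ => hproj e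

/-- Right multiplication by `localX e` flips the column index of a matrix unit at `e`, so all matrix
units arise from the diagonal ones. -/
theorem subalgebra_eq_top_of_pauli_mem {Λ : Finset Edge} (D : Subalgebra ℂ (LocalAlgebra Λ))
    (hX : ∀ e, localX e ∈ D) (hZ : ∀ e, localZ e ∈ D) : D = ⊤ := by
  have hflip (s t : Λ → Fin 2) (e : Λ) (h : Matrix.single s t (1 : ℂ) ∈ D) :
      Matrix.single s (flipAt e t) (1 : ℂ) ∈ D := by
    have : Matrix.single s (flipAt e t) (1 : ℂ) = Matrix.single s t (1 : ℂ) * localX e := by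
      ext u v
      rw [mul_localX_apply, Matrix.single_apply, Matrix.single_apply,
        if_congr (and_congr_right' ((eq_comm.trans (eq_flipAt_comm e t v)))) rfl rfl]
    rw [this]
    exact D.mul_mem h (hX e)
  have hupdate (s t : Λ → Fin 2) (e : Λ) (a : Fin 2) (h : Matrix.single s t (1 : ℂ) ∈ D) :
      Matrix.single s (Function.update t e a) (1 : ℂ) ∈ D := by
    by_cases ha : a = t e
    · rwa [ha, Function.update_eq_self]
    · have : a = 1 - t e := by omega
      rw [this]
      exact hflip s t e h
  have hsingle (s t : Λ → Fin 2) : Matrix.single s t (1 : ℂ) ∈ D := by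
    -- `F` is the set of sites where the column index has already been changed from `s` to `t`.
    have (F : Finset Λ) : Matrix.single s (fun e => if e ∈ F then t e else s e) (1 : ℂ) ∈ D := by
      induction F using Finset.induction_on with
      | empty => simpa using single_one_mem_of_localZ_mem D hZ s
      | insert e F he ih =>
        convert hupdate _ _ e (t e) ih using 2
        funext f
        by_cases hf : f = e
        · subst hf; simp
        · simp [hf]
    simpa using this Finset.univ
  refine eq_top_iff.2 fun m _ => ?_
  rw [Matrix.matrix_eq_sum_single m]
  refine D.sum_mem fun s _ => D.sum_mem fun t _ => ?_
  rw [← mul_one (m s t), ← smul_eq_mul, ← Matrix.smul_single]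
  exact D.smul_mem (hsingle s t) _

theorem localEmbedding_mem_adjoin_pauli (Λ : Finset Edge) (a : LocalAlgebra Λ) :
    localEmbedding Λ a ∈ Algebra.adjoin ℂ (Set.range sigmaX ∪ Set.range sigmaZ) := by
  have h := subalgebra_eq_top_of_pauli_mem
    ((Algebra.adjoin ℂ (Set.range sigmaX ∪ Set.range sigmaZ)).comap
      (localEmbedding Λ : LocalAlgebra Λ →ₐ[ℂ] QuasiLocal))
    (fun e => Algebra.subset_adjoin (Or.inl ⟨e, (localEmbedding_localX e).symm⟩))
    (fun e => Algebra.subset_adjoin (Or.inr ⟨e, (localEmbedding_localZ e).symm⟩))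
  exact (h ▸ Algebra.mem_top : a ∈ Subalgebra.comap _ _)

theorem dense_adjoin_pauli :
    Dense (Algebra.adjoin ℂ (Set.range sigmaX ∪ Set.range sigmaZ) : Set QuasiLocal) := by
  refine dense_iUnion_range_localEmbedding.mono (Set.iUnion_subset fun Λ => ?_)
  rintro _ ⟨a, rfl⟩
  exact localEmbedding_mem_adjoin_pauli Λ a

/-! ### Chains of edges modulo two -/

/-- The `ℤ/2`-chains of edges. -/
abbrev Chain : Type := Edge →₀ ZMod 2

theorem chain_induction {p : Chain → Prop} (T : Chain) (h0 : p 0)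
    (hadd : ∀ S T, p S → p T → p (S + T)) (hone : ∀ e, p (Finsupp.single e 1)) : p T := by
  induction T using Finsupp.induction_linear with
  | zero => exact h0
  | add S T hS hT => exact hadd S T hS hT
  | single e c =>
    fin_cases c
    · exact (Finsupp.single_zero e : Finsupp.single e (0 : ZMod 2) = 0).symm ▸ h0
    · exact hone e

theorem chain_add_self (T : Chain) : T + T = 0 := by
  ext e
  exact CharTwo.add_self_eq_zero (T e)

/-- The chain of a list of edges. -/
def listChain (l : List Edge) : Chain := (l.map fun e => Finsupp.single e 1).sum

/-- The number of edges of a chain at a vertex, modulo two. -/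
theorem sum_map_starEdges (f : Edge → ZMod 2) (x y : ℤ) :
    ((starEdges (x, y)).map f).sum =
      f ((x, y), false) + (f ((x, y), true) + (f ((x - 1, y), false) + f ((x, y - 1), true))) := by
  simp [starEdges]

theorem listChain_faceEdges (x y : ℤ) : listChain (faceEdges (x, y)) =
    Finsupp.single ((x, y), false) 1 + (Finsupp.single ((x + 1, y), true) 1 +
      (Finsupp.single ((x, y + 1), false) 1 + Finsupp.single ((x, y), true) 1)) := by
  simp [listChain, faceEdges]

/-- A star and a face boundary share either no edge or two. This parity both makes boundaries cycles
and makes `A_v` commute with `B_p`. -/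
theorem sum_starEdges_listChain_faceEdges (v : Vertex) (p : Face) :
    ((starEdges v).map (listChain (faceEdges p))).sum = 0 := by
  obtain ⟨x, y⟩ := v
  obtain ⟨a, b⟩ := p
  have h11 : (1 : ZMod 2) + 1 = 0 := rfl
  have ha : a + 1 = x ↔ a = x - 1 := by omega
  have hn (n : ℤ) : n ≠ n - 1 := by omega
  have hb : b + 1 = y ↔ b = y - 1 := by omega
  rw [sum_map_starEdges, listChain_faceEdges]
  simp only [Finsupp.add_apply, Finsupp.single_apply, Prod.mk.injEq, add_zero,
    and_true, and_false, if_false, Bool.false_eq_true, reduceCtorEq, zero_add, ha, hb]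
  -- The vertex is a corner of the face exactly when `a ∈ {x, x - 1}` and `b ∈ {y, y - 1}`.
  by_cases h1 : a = x
  · by_cases h3 : b = y
    · subst h1 h3; simp [h11, hn, add_comm]
    · by_cases h4 : b = y - 1
      · subst h1 h4; simp [h11, hn]
      · simp [h3, h4]
  · by_cases h2 : a = x - 1
    · by_cases h3 : b = y
      · subst h2 h3; simp [h11, hn, add_comm]
      · by_cases h4 : b = y - 1
        · subst h2 h4; simp [h11, add_comm]
        · simp [h3, h4]
    · simp [h1, h2]

/-- The group of boundaries of finite sets of faces. -/
def boundaries : AddSubgroup Chain :=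
  AddSubgroup.closure (Set.range fun p => listChain (faceEdges p))

theorem sum_starEdges_eq_zero_of_mem_boundaries {T : Chain} (hT : T ∈ boundaries) (v : Vertex) :
    ((starEdges v).map T).sum = 0 := by
  induction hT using AddSubgroup.closure_induction with
  | mem T hT => obtain ⟨p, rfl⟩ := hT; exact sum_starEdges_listChain_faceEdges v p
  | zero => obtain ⟨x, y⟩ := v; simp [sum_map_starEdges]
  | add S T _ _ hS hT =>
    obtain ⟨x, y⟩ := v
    rw [sum_map_starEdges] at *
    simp only [Finsupp.add_apply]
    linear_combination hS + hT
  | neg T _ hT =>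
    obtain ⟨x, y⟩ := v
    rw [sum_map_starEdges] at *
    simp only [Finsupp.neg_apply]
    linear_combination -hT

/-- The chains whose horizontal edges all lie in the row `y = 0`. -/
def zeroRowChains : AddSubgroup Chain where
  carrier := {T | ∀ x y, y ≠ 0 → T ((x, y), false) = 0}
  zero_mem' := fun _ _ _ => rfl
  add_mem' := fun hS hT x y h => by rw [Finsupp.add_apply, hS x y h, hT x y h, add_zero]
  neg_mem' := fun hT x y h => by rw [Finsupp.neg_apply, hT x y h, neg_zero]

theorem single_vertical_mem_zeroRowChains (x y : ℤ) :
    Finsupp.single ((x, y), true) 1 ∈ zeroRowChains := fun _ _ _ => by simp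

/-- Modulo boundaries, horizontal edges can be moved to the row `y = 0`. -/
theorem boundaries_sup_zeroRowChains : boundaries ⊔ zeroRowChains = ⊤ := by
  have hV (x y : ℤ) : Finsupp.single ((x, y), true) 1 ∈ boundaries ⊔ zeroRowChains :=
    AddSubgroup.mem_sup_right (single_vertical_mem_zeroRowChains x y)
  -- The bottom and top of a face add up to its boundary minus its two vertical sides, and vertical
  -- edges are in `zeroRowChains`. So a horizontal edge may be moved one row up or down.
  have hF (x y : ℤ) : Finsupp.single ((x, y), false) 1 + Finsupp.single ((x, y + 1), false) 1 ∈
      boundaries ⊔ zeroRowChains := by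
    have h : listChain (faceEdges (x, y)) ∈ boundaries ⊔ zeroRowChains :=
      AddSubgroup.mem_sup_left (AddSubgroup.subset_closure ⟨_, rfl⟩)
    rw [listChain_faceEdges] at h
    convert sub_mem (sub_mem h (hV x y)) (hV (x + 1) y) using 1
    abel
  have hH (x y : ℤ) : Finsupp.single ((x, y), false) 1 ∈ boundaries ⊔ zeroRowChains := by
    induction y using Int.induction_on with
    | zero =>
      refine AddSubgroup.mem_sup_right fun x' y' h => ?_
      rw [Finsupp.single_apply, if_neg]
      simp [h.symm]
    | succ y ih => exact (add_mem_cancel_left ih).1 (hF x y)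
    | pred y ih =>
      have := hF x (-y - 1)
      rw [sub_add_cancel] at this
      exact (add_mem_cancel_right ih).1 this
  have hone (e : Edge) : Finsupp.single e 1 ∈ boundaries ⊔ zeroRowChains := by
    obtain ⟨⟨x, y⟩, _ | _⟩ := e
    exacts [hH x y, hV x y]
  exact eq_top_iff.2 fun T _ => chain_induction T (zero_mem _) (fun _ _ => add_mem) hone

/-- A nonzero constant value along infinitely many distinct edges would contradict finite support.
-/
theorem chain_eq_zero_of_eventually_const (T : Chain) (g : ℕ → Edge) (hg : Function.Injective g)
    (h : ∀ n, T (g (n + 1)) = T (g n)) : T (g 0) = 0 := by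
  by_contra h0
  have hn (n : ℕ) : T (g n) = T (g 0) := by
    induction n with
    | zero => rfl
    | succ n ih => rw [h, ih]
  refine Set.infinite_range_of_injective hg (T.support.finite_toSet.subset ?_)
  rintro _ ⟨n, rfl⟩
  simpa [hn n] using h0

/-- A finite cycle of the square lattice is a boundary. -/
theorem mem_boundaries {T : Chain} (hT : ∀ v, ((starEdges v).map T).sum = 0) :
    T ∈ boundaries := by
  obtain ⟨B, hB, N, hN, rfl⟩ :=
    AddSubgroup.mem_sup.1 (boundaries_sup_zeroRowChains ▸ AddSubgroup.mem_top T)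
  have hcyc (x y : ℤ) : N ((x, y), false) + (N ((x, y), true) +
      (N ((x - 1, y), false) + N ((x, y - 1), true))) = 0 := by
    have h1 := hT (x, y)
    have h2 := sum_starEdges_eq_zero_of_mem_boundaries hB (x, y)
    rw [sum_map_starEdges] at h1 h2
    simp only [Finsupp.add_apply] at h1
    linear_combination h1 - h2
  -- Off the row `y = 0` there are no horizontal edges, so the cycle condition equates the vertical
  -- edges above and below the vertex.
  have hvert (x y : ℤ) (hy : y ≠ 0) : N ((x, y), true) = N ((x, y - 1), true) := by
    have h := hcyc x y
    rw [hN x y hy, hN (x - 1) y hy, zero_add, zero_add] at h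
    exact CharTwo.add_eq_zero.1 h
  have hV (x y : ℤ) : N ((x, y), true) = 0 := by
    -- Go up to infinity when `y ≥ 0` and down when `y < 0`: in either case the vertices passed are
    -- off the row `y = 0`, as `hvert` requires.
    rcases le_or_gt 0 y with hy | hy
    · have := chain_eq_zero_of_eventually_const N (fun n => ((x, y + n), true))
        (fun m n h => by simpa using h) (fun n => by
          rw [hvert x _ (by omega)]; congr 3; push_cast; ring)
      simpa using this
    · have := chain_eq_zero_of_eventually_const N (fun n => ((x, y - n), true))
        (fun m n h => by simpa using h) (fun n => by
          rw [hvert x (y - n) (by omega)]; congr 3; push_cast; ring)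
      simpa using this
  -- With the vertical edges gone, the cycle condition in row `0` equates consecutive horizontal
  -- edges.
  have hH (x : ℤ) : N ((x, 0), false) = 0 := by
    have := chain_eq_zero_of_eventually_const N (fun n => ((x + n, 0), false))
      (fun m n h => by simpa using h) (fun n => by
        have h := hcyc (x + (n + 1 : ℕ)) 0
        rw [hV, hV, zero_add, add_zero] at h
        rw [CharTwo.add_eq_zero.1 h]; congr 3; push_cast; ring)
    simpa using this
  have : N = 0 := by
    ext ⟨⟨x, y⟩, _ | _⟩
    · by_cases hy : y = 0
      · rw [hy, hH]; rfl
      · exact hN x y hy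
    · exact hV x y
  rwa [this, add_zero]

/-! ### Duality -/

/-- The symmetry of the set of edges that exchanges stars and boundaries of faces. -/
def dualEdge : Edge ≃ Edge where
  toFun e := (-e.1, !e.2)
  invFun e := (-e.1, !e.2)
  left_inv e := by simp
  right_inv e := by simp

/-- The two lists differ by a rotation by one place. -/
theorem map_dualEdge_starEdges_perm (v : Vertex) :
    ((starEdges v).map dualEdge).Perm (faceEdges (-v)) := by
  obtain ⟨x, y⟩ := v
  simp only [starEdges, faceEdges, dualEdge, Equiv.coe_fn_mk, List.map_cons, List.map_nil,
    Prod.neg_mk, Bool.not_false, Bool.not_true, neg_sub', sub_neg_eq_add]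
  exact (List.perm_append_singleton _ _).symm

theorem map_dualEdge_faceEdges_perm (p : Face) :
    ((faceEdges p).map dualEdge).Perm (starEdges (-p)) := by
  have h := (map_dualEdge_starEdges_perm (-p)).symm.map dualEdge
  rw [neg_neg, List.map_map, show dualEdge ∘ dualEdge = id from funext dualEdge.left_inv,
    List.map_id] at h
  exact h

theorem listChain_perm {l l' : List Edge} (h : l.Perm l') : listChain l = listChain l' :=
  (h.map _).sum_eq

/-- The group generated by the stars. -/
def coboundaries : AddSubgroup Chain :=
  AddSubgroup.closure (Set.range fun v => listChain (starEdges v))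

theorem domCongr_listChain (l : List Edge) :
    Finsupp.domCongr dualEdge (listChain l) = listChain (l.map dualEdge) := by
  rw [listChain, listChain, map_list_sum, List.map_map, List.map_map]
  congr 2
  funext e
  simp [Finsupp.domCongr]

/-- A finite cycle of the dual lattice is a sum of stars. -/
theorem mem_coboundaries {T : Chain} (hT : ∀ p, ((faceEdges p).map T).sum = 0) :
    T ∈ coboundaries := by
  have h : (Finsupp.domCongr dualEdge T : Chain) ∈ boundaries := by
    refine mem_boundaries fun v => ?_
    rw [← hT (-v), ← ((map_dualEdge_starEdges_perm v).map T).sum_eq, List.map_map]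
    congr 1
  have hle : boundaries ≤ coboundaries.comap
      (Finsupp.domCongr (M := ZMod 2) dualEdge).toAddMonoidHom := by
    refine (AddSubgroup.closure_le _).2 ?_
    rintro _ ⟨p, rfl⟩
    refine AddSubgroup.subset_closure ⟨-p, ?_⟩
    exact ((domCongr_listChain _).trans (listChain_perm (map_dualEdge_faceEdges_perm p))).symm
  have h' : Finsupp.domCongr dualEdge (Finsupp.domCongr dualEdge T) ∈ coboundaries := hle h
  convert h'
  ext e
  change T e = T (dualEdge.symm (dualEdge.symm e))
  exact congrArg T (dualEdge.left_inv e).symm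

/-! ### Products of commuting involutions -/

/-- The submonoid `M` generated by the `s i` is commutative and each `s i` is its own inverse there,
so each gives a homomorphism from `ZMod 2` to the units of `M`, and these extend to finitely
supported functions. Products then need no ordering, and multiplying them is adding chains. -/
theorem exists_mulHom_of_involutions {ι A : Type*} [Monoid A] (s : ι → A)
    (hs : ∀ i, s i * s i = 1) (hc : ∀ i j, Commute (s i) (s j)) :
    ∃ f : (ι →₀ ZMod 2) → A, f 0 = 1 ∧ (∀ S T, f (S + T) = f S * f T) ∧
      ∀ i, f (Finsupp.single i 1) = s i := by
  let M := Submonoid.closure (Set.range s)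
  have hM : IsMulCommutative M := Submonoid.isMulCommutative_closure A (by
    rintro _ ⟨i, rfl⟩ _ ⟨j, rfl⟩
    exact hc i j)
  let _ : CommMonoid M := { (inferInstance : Monoid M) with mul_comm := hM.is_comm.comm }
  let s' (i : ι) : M := ⟨s i, Submonoid.subset_closure ⟨i, rfl⟩⟩
  have hs' (i : ι) : s' i * s' i = 1 := Subtype.ext (hs i)
  let u (i : ι) : Mˣ := ⟨s' i, s' i, hs' i, hs' i⟩
  let g (i : ι) : ZMod 2 →+ Additive Mˣ :=
    ZMod.lift 2 ⟨zmultiplesHom _ (Additive.ofMul (u i)), by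
      change ((2 : ℕ) : ℤ) • Additive.ofMul (u i) = 0
      rw [natCast_zsmul, two_nsmul]
      exact congrArg Additive.ofMul (Units.ext (hs' i))⟩
  let F : (ι →₀ ZMod 2) →+ Additive Mˣ := Finsupp.liftAddHom (N := Additive Mˣ) g
  refine ⟨fun T => (((F T).toMul : Mˣ) : M), ?_, fun S T => ?_, fun i => ?_⟩
  · beta_reduce; rw [map_zero]; rfl
  · beta_reduce; rw [map_add]; rfl
  · have : F (Finsupp.single i 1) = Additive.ofMul (u i) := by
      rw [Finsupp.liftAddHom_apply_single]
      change ZMod.lift 2 _ ((1 : ℤ) : ZMod 2) = _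
      rw [ZMod.lift_coe]
      simp
    beta_reduce; rw [this]; rfl

/-- The product of `σˣ` over the edges of a chain. -/
def chainX : Chain → QuasiLocal :=
  (exists_mulHom_of_involutions sigmaX sigmaX_mul_self sigmaX_comm).choose

/-- The product of `σᶻ` over the edges of a chain. -/
def chainZ : Chain → QuasiLocal :=
  (exists_mulHom_of_involutions sigmaZ sigmaZ_mul_self sigmaZ_comm).choose

theorem chainX_zero : chainX 0 = 1 :=
  (exists_mulHom_of_involutions sigmaX sigmaX_mul_self sigmaX_comm).choose_spec.1

theorem chainX_add (S T : Chain) : chainX (S + T) = chainX S * chainX T :=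
  (exists_mulHom_of_involutions sigmaX sigmaX_mul_self sigmaX_comm).choose_spec.2.1 S T

theorem chainX_single (e : Edge) : chainX (Finsupp.single e 1) = sigmaX e :=
  (exists_mulHom_of_involutions sigmaX sigmaX_mul_self sigmaX_comm).choose_spec.2.2 e

theorem chainZ_zero : chainZ 0 = 1 :=
  (exists_mulHom_of_involutions sigmaZ sigmaZ_mul_self sigmaZ_comm).choose_spec.1

theorem chainZ_add (S T : Chain) : chainZ (S + T) = chainZ S * chainZ T :=
  (exists_mulHom_of_involutions sigmaZ sigmaZ_mul_self sigmaZ_comm).choose_spec.2.1 S T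

theorem chainZ_single (e : Edge) : chainZ (Finsupp.single e 1) = sigmaZ e :=
  (exists_mulHom_of_involutions sigmaZ sigmaZ_mul_self sigmaZ_comm).choose_spec.2.2 e

theorem chainX_mul_self (T : Chain) : chainX T * chainX T = 1 := by
  rw [← chainX_add, chain_add_self, chainX_zero]

theorem chainZ_mul_self (T : Chain) : chainZ T * chainZ T = 1 := by
  rw [← chainZ_add, chain_add_self, chainZ_zero]

theorem chainX_comm (S T : Chain) : chainX S * chainX T = chainX T * chainX S := by
  rw [← chainX_add, add_comm, chainX_add]

theorem chainZ_comm (S T : Chain) : chainZ S * chainZ T = chainZ T * chainZ S := by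
  rw [← chainZ_add, add_comm, chainZ_add]

theorem star_chainX (T : Chain) : star (chainX T) = chainX T := by
  induction T using chain_induction with
  | h0 => rw [chainX_zero, star_one]
  | hadd S T hS hT => rw [chainX_add, star_mul, hS, hT, chainX_comm]
  | hone e => rw [chainX_single, star_sigmaX]

theorem star_chainZ (T : Chain) : star (chainZ T) = chainZ T := by
  induction T using chain_induction with
  | h0 => rw [chainZ_zero, star_one]
  | hadd S T hS hT => rw [chainZ_add, star_mul, hS, hT, chainZ_comm]
  | hone e => rw [chainZ_single, star_sigmaZ]

theorem chainX_listChain (l : List Edge) : chainX (listChain l) = (l.map sigmaX).prod := by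
  induction l with
  | nil => exact chainX_zero
  | cons e l ih =>
    rw [List.map_cons, List.prod_cons, ← ih, ← chainX_single, ← chainX_add]
    rfl

theorem chainZ_listChain (l : List Edge) : chainZ (listChain l) = (l.map sigmaZ).prod := by
  induction l with
  | nil => exact chainZ_zero
  | cons e l ih =>
    rw [List.map_cons, List.prod_cons, ← ih, ← chainZ_single, ← chainZ_add]
    rfl

theorem starOperator_eq (v : Vertex) : starOperator v = chainX (listChain (starEdges v)) :=
  (chainX_listChain _).symm

theorem faceOperator_eq (p : Face) : faceOperator p = chainZ (listChain (faceEdges p)) :=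
  (chainZ_listChain _).symm

/-! ### Commutation relations of Pauli operators -/

/-- The sign `(-1)ᵃ`. -/
def parity (a : ZMod 2) : ℂ := if a = 0 then 1 else -1

theorem parity_add (a b : ZMod 2) : parity (a + b) = parity a * parity b := by
  have h : ∀ c : ZMod 2, c = 0 ∨ c = 1 := by decide
  have h11 : (1 : ZMod 2) + 1 = 0 := rfl
  rcases h a with rfl | rfl <;> rcases h b with rfl | rfl <;> simp [parity, h11]

theorem parity_zero : parity 0 = 1 := by simp [parity]

theorem parity_one : parity 1 = -1 := by simp [parity]

theorem parity_mul_self (a : ZMod 2) : parity a * parity a = 1 := by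
  rw [← parity_add, CharTwo.add_self_eq_zero, parity_zero]

theorem sigmaX_mul_sigmaZ (e f : Edge) :
    sigmaX e * sigmaZ f = parity (Finsupp.single e 1 f) • (sigmaZ f * sigmaX e) := by
  by_cases h : f = e
  · rw [h, Finsupp.single_eq_same, parity_one, neg_one_smul, sigmaX_mul_sigmaZ_same]
  · rw [Finsupp.single_eq_of_ne h, parity_zero, one_smul, (sigmaX_comm_sigmaZ h).eq]

theorem mul_mul_eq_smul {A : Type*} [Ring A] [Algebra ℂ A] {a b c : A} {r s : ℂ}
    (hb : a * b = r • (b * a)) (hc : a * c = s • (c * a)) :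
    a * (b * c) = (r * s) • (b * c * a) := by
  rw [← mul_assoc, hb, smul_mul_assoc, mul_assoc, hc, mul_smul_comm, smul_smul, ← mul_assoc]

theorem mul_mul_eq_smul' {A : Type*} [Ring A] [Algebra ℂ A] {a b c : A} {r s : ℂ}
    (ha : a * c = r • (c * a)) (hb : b * c = s • (c * b)) :
    a * b * c = (r * s) • (c * (a * b)) := by
  rw [mul_assoc, hb, mul_smul_comm, ← mul_assoc, ha, smul_mul_assoc, smul_smul, mul_comm s,
    mul_assoc]

theorem sigmaX_mul_chainZ (e : Edge) (T : Chain) :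
    sigmaX e * chainZ T = parity (T e) • (chainZ T * sigmaX e) := by
  induction T using chain_induction with
  | h0 => rw [chainZ_zero, mul_one, one_mul, Finsupp.zero_apply, parity_zero, one_smul]
  | hadd S T hS hT => rw [chainZ_add, mul_mul_eq_smul hS hT, Finsupp.add_apply, parity_add]
  | hone f =>
    rw [chainZ_single, sigmaX_mul_sigmaZ, Finsupp.single_apply, Finsupp.single_apply,
      if_congr eq_comm rfl rfl]

theorem chainX_mul_sigmaZ (S : Chain) (e : Edge) :
    chainX S * sigmaZ e = parity (S e) • (sigmaZ e * chainX S) := by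
  induction S using chain_induction with
  | h0 => rw [chainX_zero, mul_one, one_mul, Finsupp.zero_apply, parity_zero, one_smul]
  | hadd S T hS hT => rw [chainX_add, mul_mul_eq_smul' hS hT, Finsupp.add_apply, parity_add]
  | hone f => rw [chainX_single, sigmaX_mul_sigmaZ]

/-- Each edge of `l` that lies in `T` contributes one sign. -/
theorem listProd_sigmaX_mul_chainZ (l : List Edge) (T : Chain) :
    (l.map sigmaX).prod * chainZ T =
      parity ((l.map T).sum) • (chainZ T * (l.map sigmaX).prod) := by
  induction l with
  | nil => simp [parity_zero]
  | cons e l ih =>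
    rw [List.map_cons, List.prod_cons, List.map_cons, List.sum_cons, parity_add,
      mul_mul_eq_smul' (sigmaX_mul_chainZ e T) ih]

theorem chainX_mul_listProd_sigmaZ (S : Chain) (l : List Edge) :
    chainX S * (l.map sigmaZ).prod =
      parity ((l.map S).sum) • ((l.map sigmaZ).prod * chainX S) := by
  induction l with
  | nil => simp [parity_zero]
  | cons e l ih =>
    rw [List.map_cons, List.prod_cons, List.map_cons, List.sum_cons, parity_add,
      mul_mul_eq_smul (chainX_mul_sigmaZ S e) ih]

/-- The Pauli operator of a pair of chains. -/
def pauli (S T : Chain) : QuasiLocal := chainX S * chainZ T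

theorem starOperator_mul_pauli (v : Vertex) (S T : Chain) :
    starOperator v * pauli S T =
      parity (((starEdges v).map T).sum) • (pauli S T * starOperator v) := by
  have h1 : starOperator v * chainX S = (1 : ℂ) • (chainX S * starOperator v) := by
    rw [starOperator_eq, chainX_comm, one_smul]
  rw [pauli, mul_mul_eq_smul h1 (listProd_sigmaX_mul_chainZ (starEdges v) T), one_mul]

theorem faceOperator_mul_pauli (p : Face) (S T : Chain) :
    faceOperator p * pauli S T =
      parity (((faceEdges p).map S).sum) • (pauli S T * faceOperator p) := by
  have h1 : chainZ T * faceOperator p = (1 : ℂ) • (faceOperator p * chainZ T) := by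
    rw [faceOperator_eq, chainZ_comm, one_smul]
  have h := mul_mul_eq_smul' (chainX_mul_listProd_sigmaZ S (faceEdges p)) h1
  change pauli S T * faceOperator p = _ • (faceOperator p * pauli S T) at h
  rw [h, mul_one, smul_smul, parity_mul_self, one_smul]

/-- Up to a scalar, Pauli strings are stable under right multiplication by Pauli matrices: moving
`sigmaX e` left past `chainZ T` costs only a sign. -/
theorem adjoin_pauli_le_span :
    (Algebra.adjoin ℂ (Set.range sigmaX ∪ Set.range sigmaZ)).toSubmodule ≤
      Submodule.span ℂ (Set.range fun q : Chain × Chain => pauli q.1 q.2) := by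
  rw [Algebra.adjoin_eq_span, Submodule.span_le]
  intro x hx
  suffices ∃ (c : ℂ) (S T : Chain), x = c • pauli S T by
    obtain ⟨c, S, T, rfl⟩ := this
    exact Submodule.smul_mem _ _ (Submodule.subset_span ⟨(S, T), rfl⟩)
  induction hx using Submonoid.closure_induction_right with
  | one => exact ⟨1, 0, 0, by rw [pauli, chainX_zero, chainZ_zero, mul_one, one_smul]⟩
  | mul_right x _ y hy ih =>
    obtain ⟨c, S, T, rfl⟩ := ih
    obtain ⟨e, rfl⟩ | ⟨e, rfl⟩ := hy
    · refine ⟨c * parity (T e), S + Finsupp.single e 1, T, ?_⟩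
      have h : chainZ T * sigmaX e = parity (T e) • (sigmaX e * chainZ T) := by
        rw [sigmaX_mul_chainZ, smul_smul, parity_mul_self, one_smul]
      rw [pauli, pauli, chainX_add, chainX_single, smul_mul_assoc, mul_assoc, h, mul_smul_comm,
        smul_smul, ← mul_assoc]
    · refine ⟨c, S, T + Finsupp.single e 1, ?_⟩
      rw [pauli, pauli, chainZ_add, chainZ_single, smul_mul_assoc, mul_assoc]

/-! ### Generated C*-subalgebras -/

section CStar

variable {A : Type*} [CStarAlgebra A]

theorem subset_generatedCStar (S : Set A) : S ⊆ generatedCStar S :=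
  (StarAlgebra.subset_adjoin ℂ S).trans (StarSubalgebra.le_topologicalClosure _)

theorem isClosed_generatedCStar (S : Set A) : IsClosed (generatedCStar S : Set A) :=
  StarSubalgebra.isClosed_topologicalClosure _

theorem generatedCStar_le {S : Set A} {B : StarSubalgebra ℂ A} (hB : IsClosed (B : Set A))
    (h : S ⊆ B) : generatedCStar S ≤ B :=
  StarSubalgebra.topologicalClosure_minimal (StarAlgebra.adjoin_le h) hB

/-- The star-subalgebra centralizer also demands commutation with `star x`; for self-adjoint
generators this is the adjoint of the relation with `x`. -/
theorem commute_of_mem_generatedCStar {S : Set A} (hS : ∀ a ∈ S, star a = a) {x : A}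
    (hx : ∀ a ∈ S, a * x = x * a) {b : A} (hb : b ∈ generatedCStar S) : b * x = x * b := by
  have hle : generatedCStar S ≤ StarSubalgebra.centralizer ℂ {x} := by
    refine generatedCStar_le (Set.isClosed_centralizer _) fun a ha => ?_
    rw [SetLike.mem_coe, StarSubalgebra.mem_centralizer_iff]
    rintro _ rfl
    refine ⟨(hx a ha).symm, ?_⟩
    have := congrArg star (hx a ha)
    rwa [star_mul, star_mul, hS a ha] at this
  exact (((StarSubalgebra.mem_centralizer_iff ℂ).1 (hle hb)) x rfl).1.symm

/-- Conjugation by a self-adjoint unitary. -/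
def conjBy (u : A) (hu : u * u = 1) (hs : star u = u) : A →⋆ₐ[ℂ] A where
  toFun a := u * a * u
  map_one' := by rw [mul_one, hu]
  map_mul' a b := by
    rw [show u * a * u * (u * b * u) = u * a * (u * u) * b * u by simp only [mul_assoc], hu, mul_one,
      mul_assoc u a b]
  map_zero' := by rw [mul_zero, zero_mul]
  map_add' a b := by rw [mul_add, add_mul]
  commutes' r := by rw [← Algebra.commutes, mul_assoc, hu, mul_one]
  map_star' a := by rw [star_mul, star_mul, hs, mul_assoc]

/-- A self-adjoint unitary that commutes or anticommutes with each generator is a normalizer. -/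
theorem isNormalizer_of_generators {S : Set A} {u : A} (hu : u * u = 1) (hs : star u = u)
    (h : ∀ g ∈ S, g * u = u * g ∨ g * u = -(u * g)) : IsNormalizer (generatedCStar S) u := by
  have hle : generatedCStar S ≤ (generatedCStar S).comap (conjBy u hu hs) := by
    -- Conjugation by `u` is a continuous star-homomorphism, so checking generators suffices.
    refine generatedCStar_le
      ((isClosed_generatedCStar S).preimage ((continuous_const_mul u).mul continuous_const)) ?_
    intro g hg
    change u * g * u ∈ generatedCStar S
    have hgS := subset_generatedCStar S hg
    rcases h g hg with h | h
    · rwa [mul_assoc, h, ← mul_assoc, hu, one_mul]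
    · rw [mul_assoc, h, mul_neg, ← mul_assoc, hu, one_mul]
      exact neg_mem hgS
  intro b hb
  rw [hs]
  exact ⟨hle hb, hle hb⟩

/-- The average of `a` over conjugation by `1` and `u`. -/
def average (u : A) : A →ₗ[ℂ] A :=
  (2⁻¹ : ℂ) • (LinearMap.id + LinearMap.mulLeft ℂ u ∘ₗ LinearMap.mulRight ℂ u)

theorem average_apply (u a : A) : average u a = (2⁻¹ : ℂ) • (a + u * (a * u)) := rfl

theorem norm_average_le {u : A} (hu : ‖u‖ ≤ 1) (a : A) : ‖average u a‖ ≤ ‖a‖ := by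
  have h : ‖u * (a * u)‖ ≤ ‖a‖ :=
    calc ‖u * (a * u)‖ ≤ ‖u‖ * (‖a‖ * ‖u‖) :=
          (norm_mul_le _ _).trans (mul_le_mul_of_nonneg_left (norm_mul_le _ _) (norm_nonneg _))
      _ ≤ 1 * (‖a‖ * 1) := by gcongr
      _ = ‖a‖ := by ring
  rw [average_apply, norm_smul]
  have h2 : ‖(2⁻¹ : ℂ)‖ = 2⁻¹ := by simp
  rw [h2]
  linarith [norm_add_le a (u * (a * u))]

theorem average_eq_self {u a : A} (hu : u * u = 1) (h : u * a = a * u) : average u a = a := by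
  rw [average_apply, ← h, ← mul_assoc, hu, one_mul, ← two_smul ℂ, smul_smul]
  norm_num

theorem average_eq_zero {u a : A} (hu : u * u = 1) (h : u * a = -(a * u)) : average u a = 0 := by
  rw [average_apply, ← neg_neg (a * u), ← h, mul_neg, ← mul_assoc, hu, one_mul, add_neg_cancel,
    smul_zero]

/-- If the span of a set `P` is dense, the C*-algebra `C` generated by commuting self-adjoint
unitaries `S` is commutative, and each element of `P` is in `C` or anticommutes with an element of
`S` (and commutes or anticommutes with each of them), then `C` is a masa. -/
theorem isMasa_generatedCStar {S P : Set A} (hsq : ∀ g ∈ S, g * g = 1)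
    (hself : ∀ g ∈ S, star g = g) (hcomm : ∀ g ∈ S, ∀ h ∈ S, g * h = h * g)
    (hdense : Dense (Submodule.span ℂ P : Set A))
    (hP : ∀ p ∈ P, ∀ g ∈ S, g * p = p * g ∨ g * p = -(p * g))
    (hmem : ∀ p ∈ P, p ∈ generatedCStar S ∨ ∃ g ∈ S, g * p = -(p * g)) :
    IsMasa (generatedCStar S) := by
  classical
  have hnorm (g : A) (hg : g ∈ S) : ‖g‖ ≤ 1 := by
    have h : ‖star g * g‖ = ‖g‖ * ‖g‖ := CStarRing.norm_star_mul_self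
    rw [hself g hg, hsq g hg] at h
    have h1 : ‖(1 : A)‖ ≤ 1 := by
      cases subsingleton_or_nontrivial A
      · rw [Subsingleton.elim (1 : A) 0, norm_zero]; exact zero_le_one
      · rw [CStarRing.norm_one]
    nlinarith [norm_nonneg g]
  have hC (g : A) (hg : g ∈ S) (c : A) (hc : c ∈ generatedCStar S) : g * c = c * g :=
    (commute_of_mem_generatedCStar hself (fun a ha => hcomm a ha g hg) hc).symm
  have hCC : (generatedCStar S : Set A) ⊆ Set.centralizer (generatedCStar S : Set A) :=
    fun c hc b hb => commute_of_mem_generatedCStar hself (fun g hg => hC g hg c hc) hb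
  -- `E` composes one average for each element of `s` not known to lie in the algebra. That every `p
  -- ∈ P` is sent to `0` or `p` keeps earlier averages from spoiling the anticommutation used by
  -- later ones.
  have hE (s : Finset A) (hs : (s : Set A) ⊆ P) : ∃ E : A →ₗ[ℂ] A, (∀ a, ‖E a‖ ≤ ‖a‖) ∧
      (∀ a ∈ Set.centralizer (generatedCStar S : Set A), E a = a) ∧
      (∀ p ∈ P, E p = 0 ∨ E p = p) ∧ ∀ p ∈ s, E p ∈ generatedCStar S := by
    induction s using Finset.induction_on with
    | empty => exact ⟨LinearMap.id, fun _ => le_rfl, fun _ _ => rfl, fun _ _ => Or.inr rfl, by simp⟩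
    | insert q s _ ih =>
      rw [Finset.coe_insert, Set.insert_subset_iff] at hs
      obtain ⟨E, hE1, hE2, hE3, hE4⟩ := ih hs.2
      rcases hmem q hs.1 with hq | ⟨g, hg, hgq⟩
      · refine ⟨E, hE1, hE2, hE3, fun p hp => ?_⟩
        rcases Finset.mem_insert.1 hp with rfl | hp
        · rwa [hE2 p (hCC hq)]
        · exact hE4 p hp
      · have hfix (a : A) (ha : a ∈ Set.centralizer (generatedCStar S : Set A)) :
            average g a = a := average_eq_self (hsq g hg) (ha g (subset_generatedCStar S hg))
        refine ⟨average g ∘ₗ E, fun a => (norm_average_le (hnorm g hg) _).trans (hE1 a),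
          fun a ha => ?_, fun p hp => ?_, fun p hp => ?_⟩
        · rw [LinearMap.comp_apply, hE2 a ha, hfix a ha]
        · rw [LinearMap.comp_apply]
          rcases hE3 p hp with h | h
          · rw [h, map_zero]; exact Or.inl rfl
          · rw [h]
            rcases hP p hp g hg with h' | h'
            · exact Or.inr (average_eq_self (hsq g hg) h')
            · exact Or.inl (average_eq_zero (hsq g hg) h')
        · rw [LinearMap.comp_apply]
          rcases Finset.mem_insert.1 hp with rfl | hp
          · rcases hE3 p hs.1 with h | h
            · rw [h, map_zero]; exact zero_mem _
            · rw [h, average_eq_zero (hsq g hg) hgq]; exact zero_mem _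
          -- `E p` is already in the algebra, hence commutes with `g` and survives the new average.
          · rw [hfix _ (hCC (hE4 p hp))]; exact hE4 p hp
  refine Set.Subset.antisymm (fun a ha => ?_) hCC
  rw [← (isClosed_generatedCStar S).closure_eq, Metric.mem_closure_iff]
  intro ε hε
  obtain ⟨b, hb, hab⟩ := Metric.dense_iff.1 hdense a ε hε
  obtain ⟨s, hs, hbs⟩ := Submodule.mem_span_finite_of_mem_span hab
  obtain ⟨E, hE1, hE2, _, hE4⟩ := hE s hs
  have hEb : E b ∈ generatedCStar S :=
    (Submodule.span_le.2 fun p hp => hE4 p hp : Submodule.span ℂ (s : Set A) ≤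
      (generatedCStar S).toSubalgebra.toSubmodule.comap E) hbs
  refine ⟨E b, hEb, ?_⟩
  rw [dist_eq_norm]
  calc ‖a - E b‖ = ‖E (a - b)‖ := by rw [map_sub, hE2 a ha]
    _ ≤ ‖a - b‖ := hE1 _
    _ < ε := by rwa [← dist_eq_norm, dist_comm]

end CStar

/-! ### The toric algebra -/

/-- The star and face operators. -/
def stabilizers : Set QuasiLocal := Set.range starOperator ∪ Set.range faceOperator

theorem stabilizer_mul_self : ∀ g ∈ stabilizers, g * g = 1 := by
  rintro _ (⟨v, rfl⟩ | ⟨p, rfl⟩)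
  · rw [starOperator_eq, chainX_mul_self]
  · rw [faceOperator_eq, chainZ_mul_self]

theorem star_stabilizer : ∀ g ∈ stabilizers, star g = g := by
  rintro _ (⟨v, rfl⟩ | ⟨p, rfl⟩)
  · rw [starOperator_eq, star_chainX]
  · rw [faceOperator_eq, star_chainZ]

theorem starOperator_comm_faceOperator (v : Vertex) (p : Face) :
    starOperator v * faceOperator p = faceOperator p * starOperator v := by
  rw [faceOperator_eq, starOperator, listProd_sigmaX_mul_chainZ,
    sum_starEdges_listChain_faceEdges, parity_zero, one_smul]

theorem stabilizer_comm : ∀ g ∈ stabilizers, ∀ h ∈ stabilizers, g * h = h * g := by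
  rintro _ (⟨v, rfl⟩ | ⟨p, rfl⟩) _ (⟨w, rfl⟩ | ⟨q, rfl⟩)
  · rw [starOperator_eq, starOperator_eq, chainX_comm]
  · exact starOperator_comm_faceOperator v q
  · exact (starOperator_comm_faceOperator w p).symm
  · rw [faceOperator_eq, faceOperator_eq, chainZ_comm]

theorem parity_smul (a : ZMod 2) (x : QuasiLocal) :
    parity a • x = x ∨ parity a • x = -x := by
  unfold parity
  split_ifs
  · exact Or.inl (one_smul _ _)
  · exact Or.inr (neg_one_smul _ _)

theorem stabilizer_mul_pauli (S T : Chain) :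
    ∀ g ∈ stabilizers, g * pauli S T = pauli S T * g ∨ g * pauli S T = -(pauli S T * g) := by
  rintro _ (⟨v, rfl⟩ | ⟨p, rfl⟩)
  · rw [starOperator_mul_pauli]; exact parity_smul _ _
  · rw [faceOperator_mul_pauli]; exact parity_smul _ _

theorem chainX_mem_toricAlgebra {S : Chain} (hS : S ∈ coboundaries) :
    chainX S ∈ toricAlgebra := by
  induction hS using AddSubgroup.closure_induction with
  | mem S hS =>
    obtain ⟨v, rfl⟩ := hS
    exact starOperator_eq v ▸ subset_generatedCStar _ (Or.inl ⟨v, rfl⟩)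
  | zero => exact chainX_zero ▸ one_mem _
  | add S T _ _ hS hT => exact chainX_add S T ▸ mul_mem hS hT
  | neg S _ hS => rwa [neg_eq_of_add_eq_zero_left (chain_add_self S)]

theorem chainZ_mem_toricAlgebra {T : Chain} (hT : T ∈ boundaries) :
    chainZ T ∈ toricAlgebra := by
  induction hT using AddSubgroup.closure_induction with
  | mem T hT =>
    obtain ⟨p, rfl⟩ := hT
    exact faceOperator_eq p ▸ subset_generatedCStar _ (Or.inr ⟨p, rfl⟩)
  | zero => exact chainZ_zero ▸ one_mem _
  | add S T _ _ hS hT => exact chainZ_add S T ▸ mul_mem hS hT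
  | neg T _ hT => rwa [neg_eq_of_add_eq_zero_left (chain_add_self T)]

/-- If `T` is not a cycle, the star at a vertex of odd parity detects it; if `S` is not a dual
cycle, an odd face does. Otherwise the vanishing of homology applies to both chains. -/
theorem pauli_mem_or_anticommutes (S T : Chain) :
    pauli S T ∈ toricAlgebra ∨ ∃ g ∈ stabilizers, g * pauli S T = -(pauli S T * g) := by
  by_cases hT : ∀ v, ((starEdges v).map T).sum = 0
  · by_cases hS : ∀ p, ((faceEdges p).map S).sum = 0
    · exact Or.inl (mul_mem (chainX_mem_toricAlgebra (mem_coboundaries hS))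
        (chainZ_mem_toricAlgebra (mem_boundaries hT)))
    · obtain ⟨p, hp⟩ := not_forall.1 hS
      refine Or.inr ⟨faceOperator p, Or.inr ⟨p, rfl⟩, ?_⟩
      rw [faceOperator_mul_pauli, parity, if_neg hp, neg_one_smul]
  · obtain ⟨v, hv⟩ := not_forall.1 hT
    refine Or.inr ⟨starOperator v, Or.inl ⟨v, rfl⟩, ?_⟩
    rw [starOperator_mul_pauli, parity, if_neg hv, neg_one_smul]

theorem isMasa_toricAlgebra : IsMasa toricAlgebra := by
  refine isMasa_generatedCStar (P := Set.range fun q : Chain × Chain => pauli q.1 q.2)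
    stabilizer_mul_self star_stabilizer stabilizer_comm
    (dense_adjoin_pauli.mono adjoin_pauli_le_span) ?_ ?_
  · rintro _ ⟨q, rfl⟩
    exact stabilizer_mul_pauli q.1 q.2
  · rintro _ ⟨q, rfl⟩
    exact pauli_mem_or_anticommutes q.1 q.2

theorem isNormalizer_chainX (S : Chain) : IsNormalizer toricAlgebra (chainX S) := by
  refine isNormalizer_of_generators (S := stabilizers) (chainX_mul_self S)
    (star_chainX S) ?_
  simpa only [pauli, chainZ_zero, mul_one] using stabilizer_mul_pauli S 0

theorem isNormalizer_chainZ (T : Chain) : IsNormalizer toricAlgebra (chainZ T) := by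
  refine isNormalizer_of_generators (S := stabilizers) (chainZ_mul_self T)
    (star_chainZ T) ?_
  simpa only [pauli, chainX_zero, one_mul] using stabilizer_mul_pauli 0 T

/-! ### Ribbon operators -/

theorem ribbonX_eq (ρ : OpenPath sideFaces) : ribbonX ρ = chainX (listChain (List.ofFn ρ.edge)) := by
  rw [chainX_listChain, List.map_ofFn]
  rfl

theorem ribbonZ_eq (ρ : OpenPath endVertices) :
    ribbonZ ρ = chainZ (listChain (List.ofFn ρ.edge)) := by
  rw [chainZ_listChain, List.map_ofFn]
  rfl

theorem isNormalizer_of_mem_ribbonOperators :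
    ∀ a ∈ ribbonOperators, IsNormalizer toricAlgebra a := by
  rintro _ (⟨ρ, rfl⟩ | ⟨ρ, rfl⟩)
  · exact ribbonZ_eq ρ ▸ isNormalizer_chainZ _
  · exact ribbonX_eq ρ ▸ isNormalizer_chainX _

/-- The path consisting of one edge. -/
def singleEdgePath {W : Type} {ends : Edge → Sym2 W} (e : Edge) (u w : W) (h : u ≠ w)
    (he : ends e = s(u, w)) : OpenPath ends where
  length := 1
  length_pos := one_pos
  vertex := ![u, w]
  edge := fun _ => e
  injective i j hij := by
    fin_cases i <;> fin_cases j <;> first | rfl | exact absurd hij h | exact absurd hij h.symm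
  joins i := by
    fin_cases i
    exact he

theorem exists_endVertices (e : Edge) : ∃ u w, u ≠ w ∧ endVertices e = s(u, w) := by
  obtain ⟨⟨x, y⟩, _ | _⟩ := e
  · exact ⟨_, _, by simp, rfl⟩
  · exact ⟨_, _, by simp, rfl⟩

theorem exists_sideFaces (e : Edge) : ∃ u w, u ≠ w ∧ sideFaces e = s(u, w) := by
  obtain ⟨⟨x, y⟩, _ | _⟩ := e
  · exact ⟨_, _, by simp, rfl⟩
  · exact ⟨_, _, by simp, rfl⟩

theorem sigmaZ_mem_ribbonOperators (e : Edge) : sigmaZ e ∈ ribbonOperators := by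
  obtain ⟨u, w, h, he⟩ := exists_endVertices e
  exact Or.inl ⟨singleEdgePath e u w h he, by simp [ribbonZ, singleEdgePath]⟩

theorem sigmaX_mem_ribbonOperators (e : Edge) : sigmaX e ∈ ribbonOperators := by
  obtain ⟨u, w, h, he⟩ := exists_sideFaces e
  exact Or.inr ⟨singleEdgePath e u w h he, by simp [ribbonX, singleEdgePath]⟩

theorem generatedCStar_ribbonOperators : generatedCStar ribbonOperators = ⊤ := by
  have hle : Algebra.adjoin ℂ (Set.range sigmaX ∪ Set.range sigmaZ) ≤
      (generatedCStar ribbonOperators).toSubalgebra := by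
    refine Algebra.adjoin_le ?_
    rintro _ (⟨e, rfl⟩ | ⟨e, rfl⟩)
    · exact subset_generatedCStar _ (sigmaX_mem_ribbonOperators e)
    · exact subset_generatedCStar _ (sigmaZ_mem_ribbonOperators e)
  have hd : Dense (generatedCStar ribbonOperators : Set QuasiLocal) := dense_adjoin_pauli.mono hle
  refine eq_top_iff.2 fun a _ => ?_
  have h := hd.closure_eq
  rw [(isClosed_generatedCStar _).closure_eq] at h
  exact (h ▸ Set.mem_univ a : a ∈ (generatedCStar ribbonOperators : Set QuasiLocal))

theorem isRegularMasa_toricAlgebra : IsRegularMasa toricAlgebra := by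
  refine ⟨isMasa_toricAlgebra, eq_top_iff.2 ?_⟩
  rw [← generatedCStar_ribbonOperators]
  exact generatedCStar_le (isClosed_generatedCStar _) fun a ha =>
    subset_generatedCStar _ (isNormalizer_of_mem_ribbonOperators a ha)

end

end ToricCode

theorem proposition3p2 :
    ToricCode.IsRegularMasa ToricCode.toricAlgebra ∧
      (∀ a ∈ ToricCode.ribbonOperators, ToricCode.IsNormalizer ToricCode.toricAlgebra a) ∧
      ToricCode.generatedCStar ToricCode.ribbonOperators = ⊤ :=
  ⟨ToricCode.isRegularMasa_toricAlgebra, ToricCode.isNormalizer_of_mem_ribbonOperators,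
    ToricCode.generatedCStar_ribbonOperators⟩
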